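/- Let $(X,d)$ be a proper geodesic metric space (closed balls are compact, and any two points are joined by a geodesic segment) with a basepoint $b\in X$. A function $f:X\to\mathbb{R}$ is called distance-like if $$\inf_{y\in L_t} d(x,y)=f(x)-t\qquad\text{for all }x\in X\text{ and all real }t\le f(x),\qquad L_t:=\{y\in X: f(y)\le t\},$$ where $\inf\emptyset=+\infty$. An almost-geodesic is a map $\gamma:T\to X$, where $T\subseteq[0,\infty)$ is unbounded and contains $0$, such that for every $\varepsilon>0$ one has $|d(\gamma(t),\gamma(s))+d(\gamma(s),\gamma(0))-t|<\varepsilon$ for all sufficiently large $s,t\in T$ with $t\ge s$. Let $B$ be the set of Busemann points, that is, of all functions $h:X\to\mathbb{R}$ such that, for some almost-geodesic $\gamma$, $h(x)=\lim_{t\to\infty}\bigl(d(x,\gamma(t))-d(b,\gamma(t))\bigr)$ for every $x\in X$; equip $B$ with the topology of pointwise convergence. Then a function $f:X\to\mathbb{R}$ is distance-like if and only if it can be written as $$f(x)=\inf_{h\in B}\bigl(h(x)+\nu(h)\bigr)\qquad\text{for all }x\in X,$$ where $\nu:B\to\mathbb{R}\cup\{\infty\}$ is lower semicontinuous and bounded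 below. Moreover, for each fixed distance-like function $f$, the set of all such maps $\nu$ satisfying this equation has a greatest element for the pointwise order. -/

import Mathlib

open Filter Topology

/-- A metric space is geodesic if any two points `x`, `y` are joined by a geodesic segment, that is,
by the image of an isometric embedding of the interval `[0, dist x y]`. -/
def IsGeodesicSpace (X : Type*) [MetricSpace X] : Prop :=
  ∀ x y : X, ∃ γ : ℝ → X, γ 0 = x ∧ γ (dist x y) = y ∧
    ∀ s ∈ Set.Icc 0 (dist x y), ∀ t ∈ Set.Icc 0 (dist x y), dist (γ s) (γ t) = |s - t|

/-- A function `f` is distance-like in Gromov's sense if the distance from `x` to the sublevel set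
`{y | f y ≤ t}` is `f x - t` whenever `t ≤ f x`. The empty set has no greatest lower bound in `ℝ`,
so the sublevel sets are in particular required to be nonempty (the infimum over the empty set
being `+∞`). -/
def IsDistanceLike {X : Type*} [MetricSpace X] (f : X → ℝ) : Prop :=
  ∀ x : X, ∀ t : ℝ, t ≤ f x → IsGLB ((fun y => dist x y) '' {y | f y ≤ t}) (f x - t)

/-- Rieffel's almost-geodesics: `T` is an unbounded subset of `[0, ∞)` containing `0`, and for every
`ε > 0` one has `|d(γ(t), γ(s)) + d(γ(s), γ(0)) - t| < ε` for all large enough `s ≤ t` in `T`.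
Only the values of `γ` on `T` matter. -/
structure IsAlmostGeodesic {X : Type*} [MetricSpace X] (T : Set ℝ) (γ : ℝ → X) : Prop where
  subset_nonneg : T ⊆ Set.Ici 0
  zero_mem : (0 : ℝ) ∈ T
  unbounded : ¬ BddAbove T
  almost_geodesic : ∀ ε > 0, ∃ N : ℝ, ∀ s ∈ T, ∀ t ∈ T, N ≤ s → s ≤ t →
    |dist (γ t) (γ s) + dist (γ s) (γ 0) - t| < ε

/-- The set of Busemann points, normalised at the basepoint `b`: the functions that are the
pointwise limit of `d(·, γ(t)) - d(b, γ(t))` as `t → ∞` in `T`, for an almost-geodesic `γ`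
defined on `T`. -/
def busemannPoints {X : Type*} [MetricSpace X] (b : X) : Set (X → ℝ) :=
  {h | ∃ (T : Set ℝ) (γ : ℝ → X), IsAlmostGeodesic T γ ∧
    ∀ x : X, Tendsto (fun t => dist x (γ t) - dist b (γ t)) (atTop ⊓ 𝓟 T) (𝓝 (h x))}

/-- The maps `ν` from the set `B` of Busemann points (with the topology of pointwise convergence)
to `ℝ ∪ {∞}` that are lower semicontinuous, bounded below, and satisfy
`f = inf_{h ∈ B} (h + ν h)`. The lower bound by a real number excludes the value `-∞`. -/
def representingMaps {X : Type*} [MetricSpace X] (b : X) (f : X → ℝ) :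
    Set (busemannPoints b → EReal) :=
  {ν | LowerSemicontinuous ν ∧ (∃ c : ℝ, ∀ h, (c : EReal) ≤ ν h) ∧
    ∀ x : X, (f x : EReal) = ⨅ h : busemannPoints b, (((h : X → ℝ) x : EReal) + ν h)}

/-!
Up to an additive constant, Busemann points are the `1`-Lipschitz functions `u` that are
approximated on every finite set by `d(·, y) + u y` with `u y` arbitrarily negative. The errors are
one-sided, so this form (`IsBusemannFunction`) combines well with infima and limits: an
almost-geodesic is recovered by choosing the points `y` one after the other, each good for the
earlier ones and for a finite piece of a dense sequence.

An infimum of such functions is distance-like, because in a geodesic space one can walk from `x`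
almost straight towards a far point `y` and stop at the prescribed level. Conversely, following
almost-steepest descent of a distance-like `f` from `x` produces a Busemann function above `f` which
almost touches it at `x` (`IsDistanceLike.exists_mem_busemannMajorants`).

The greatest representing map is the subtle point: a large `ν` uses few Busemann functions, so one
has to find those which no representation can avoid. Let `M` be the set of Busemann functions above
`f`, and consider the minimal elements of its closure in the product topology; by Zorn's lemma every
majorant dominates one. Take a representing map `ν`, with `E` the set of all `h + c` with
`ν h ≤ c`. Given `w` in the closure of `M`, touch `f` by elements of `E` at points far along the
descent of majorants close to `w`; a limit of these is an element of the closure of `E` below `w`.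
If `w` is minimal, it equals this limit, so it belongs to the closure of `E`, for every `ν`
(`mem_closure_of_minimal`). When such a `w` is itself a Busemann function `h + c`, lower
semicontinuity gives `ν h ≤ c`.

There is no reason for a minimal element to be a Busemann function, but the closure of the set of
minimal elements contains Busemann functions that are almost as small at a given point
(`exists_isBusemannFunction_mem_closure_minimal`). Indeed, by compactness, minimality forces all
elements of the closure of `M` below a majorant near `w` to be near `w` as well, so a minimal
element can be perturbed slightly, on a finite set, to another one that looks there like
`d(·, y)` plus a constant with `y` far away; iterating along growing finite sets gives a Busemann
function in the limit. Hence the essential functions, forming the closed set generated by the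
minimal elements and by adding nonnegative constants, already represent `f`, and the map they define
is the greatest one.
-/

/-! ### Busemann functions and almost-geodesics -/

section

variable {X : Type*} [MetricSpace X]

/-- A Busemann point up to an additive constant, described without paths: a `1`-Lipschitz function
which on every finite set is approximated from above by `d(·, y) + u y` with `u y` arbitrarily
negative. The matching bound from below is the Lipschitz condition. -/
def IsBusemannFunction (u : X → ℝ) : Prop :=
  (∀ x y, u x ≤ u y + dist x y) ∧
    ∀ (F : Finset X) (ε : ℝ), 0 < ε → ∀ R : ℝ, ∃ y, u y ≤ R ∧ ∀ x ∈ F, dist x y + u y ≤ u x + ε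

lemma IsBusemannFunction.add_const {u : X → ℝ} (hu : IsBusemannFunction u) (c : ℝ) :
    IsBusemannFunction fun x => u x + c := by
  refine ⟨fun x y => by linarith [hu.1 x y], fun F ε hε R => ?_⟩
  obtain ⟨y, hy, hF⟩ := hu.2 F ε hε (R - c)
  exact ⟨y, by linarith, fun x hx => by linarith [hF x hx]⟩

lemma IsAlmostGeodesic.neBot {T : Set ℝ} {γ : ℝ → X} (h : IsAlmostGeodesic T γ) :
    (atTop ⊓ 𝓟 T : Filter ℝ).NeBot := by
  rw [inf_principal_neBot_iff]
  intro U hU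
  obtain ⟨a, ha⟩ := mem_atTop_sets.1 hU
  obtain ⟨t, ht, hat⟩ := not_bddAbove_iff.1 h.unbounded a
  exact ⟨t, ha t hat.le, ht⟩

lemma eventually_atTop_inf_principal {T : Set ℝ} (N : ℝ) :
    ∀ᶠ t in atTop ⊓ 𝓟 T, N ≤ t ∧ t ∈ T :=
  ((eventually_ge_atTop N).filter_mono inf_le_left).and
    ((eventually_principal.2 fun _ h => h).filter_mono inf_le_right)

lemma busemannPoints_apply_base {b : X} {h : X → ℝ} (hh : h ∈ busemannPoints b) : h b = 0 := by
  obtain ⟨T, γ, hγ, hlim⟩ := hh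
  have := hγ.neBot
  have := hlim b
  simp only [sub_self] at this
  exact tendsto_nhds_unique this tendsto_const_nhds

lemma isBusemannFunction_of_mem_busemannPoints {b : X} {h : X → ℝ} (hh : h ∈ busemannPoints b) :
    IsBusemannFunction h := by
  obtain ⟨T, γ, hγ, hlim⟩ := hh
  have := hγ.neBot
  -- The case `s = t` of the almost-geodesic condition.
  have hself : Tendsto (fun t => dist (γ 0) (γ t) - t) (atTop ⊓ 𝓟 T) (𝓝 0) := by
    rw [Metric.tendsto_nhds]
    intro ε hε
    obtain ⟨N, hN⟩ := hγ.almost_geodesic ε hε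
    filter_upwards [eventually_atTop_inf_principal N] with t ht
    have := hN t ht.2 t ht.2 ht.1 le_rfl
    rw [dist_self, zero_add, dist_comm] at this
    rwa [Real.dist_eq, sub_zero]
  have hx : ∀ x, Tendsto (fun t => dist x (γ t) - t) (atTop ⊓ 𝓟 T) (𝓝 (h x - h (γ 0))) := by
    intro x
    have := ((hlim x).sub (hlim (γ 0))).add hself
    rw [add_zero] at this
    exact this.congr fun t => by ring
  have hγt : Tendsto (fun s => h (γ s) + s) (atTop ⊓ 𝓟 T) (𝓝 (h (γ 0))) := by
    rw [Metric.tendsto_nhds]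
    intro ε hε
    obtain ⟨N, hN⟩ := hγ.almost_geodesic (ε / 3) (by linarith)
    filter_upwards [eventually_atTop_inf_principal N] with s hs
    have h1 := hN s hs.2 s hs.2 hs.1 le_rfl
    have h2 : |h (γ s) - h (γ 0) + dist (γ s) (γ 0)| ≤ ε / 3 := by
      refine le_of_tendsto ((hx (γ s)).add_const (dist (γ s) (γ 0))).abs ?_
      filter_upwards [eventually_atTop_inf_principal (max N s)] with t ht
      have := hN s hs.2 t ht.2 hs.1 ((le_max_right _ _).trans ht.1)
      rw [dist_comm (γ t)] at this
      rw [show dist (γ s) (γ t) - t + dist (γ s) (γ 0)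
        = dist (γ s) (γ t) + dist (γ s) (γ 0) - t by ring]
      exact this.le
    rw [dist_self, zero_add] at h1
    rw [Real.dist_eq]
    rw [abs_lt] at h1 ⊢
    rw [abs_le] at h2
    constructor <;> linarith
  refine ⟨fun x y => ?_, fun F ε hε R => ?_⟩
  · refine le_of_tendsto_of_tendsto (hlim x) ((hlim y).add_const (dist x y)) ?_
    filter_upwards with t
    linarith [dist_triangle x y (γ t)]
  · have hev : ∀ᶠ s in atTop ⊓ 𝓟 T, ∀ x ∈ F, dist x (γ s) + h (γ s) < h x + ε := by
      rw [Finset.eventually_all]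
      intro x _
      have := (hx x).add hγt
      rw [sub_add_cancel] at this
      filter_upwards [this.eventually_lt_const (show h x < h x + ε by linarith)] with s hs
      linarith
    have hev2 := hγt.eventually_lt_const (show h (γ 0) < h (γ 0) + 1 by linarith)
    obtain ⟨s, ⟨h1, h2⟩, h3⟩ := ((hev.and hev2).and
      (eventually_atTop_inf_principal (h (γ 0) + 1 - R))).exists
    exact ⟨γ s, by linarith [h3.1], fun x hx => (h1 x hx).le⟩

/-- A step that applies to any finite set can be iterated along increasing finite sets which absorb
the points produced so far and the values of a prescribed sequence `d`. -/
lemma exists_seq_of_step {X α : Type*} (d : ℕ → X) (P : α → Prop)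
    (Q : ℕ → Finset X → α → α → X → Prop)
    (step : ∀ n F a, P a → ∃ a' y, P a' ∧ Q n F a a' y) (a₀ : α) (h₀ : P a₀) (F₀ : Finset X) :
    ∃ (a : ℕ → α) (y : ℕ → X) (F : ℕ → Finset X), a 0 = a₀ ∧ F 0 = F₀ ∧ Monotone F ∧
      (∀ n, d n ∈ F (n + 1)) ∧ (∀ n, y n ∈ F (n + 1)) ∧ (∀ n, P (a n)) ∧
      ∀ n, Q n (F n) (a n) (a (n + 1)) (y n) := by
  classical
  choose A Y hA hQ using step
  let S : ℕ → {a // P a} × Finset X := fun n => Nat.rec (⟨a₀, h₀⟩, F₀)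
    (fun n s => (⟨A n s.2 s.1.1 s.1.2, hA _ _ _ _⟩,
      insert (Y n s.2 s.1.1 s.1.2) (insert (d n) s.2))) n
  refine ⟨fun n => (S n).1.1, fun n => Y n (S n).2 (S n).1.1 (S n).1.2, fun n => (S n).2,
    rfl, rfl, monotone_nat_of_le_succ fun n => ?_, fun n => ?_, fun n => ?_,
    fun n => (S n).1.2, fun n => hQ _ _ _ _⟩
  · exact (Finset.subset_insert _ _).trans (Finset.subset_insert _ _)
  · exact Finset.mem_insert_of_mem (Finset.mem_insert_self _ _)
  · exact Finset.mem_insert_self _ _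

/-- A Busemann function, normalised at `b`, is a Busemann point. The almost-geodesic starts at `b`
and is parametrised by the decrease `u b - u (a n)` of `u`. -/
lemma sub_apply_base_mem_busemannPoints [TopologicalSpace.SeparableSpace X] (b : X) {u : X → ℝ}
    (hu : IsBusemannFunction u) : (fun x => u x - u b) ∈ busemannPoints b := by
  have : Nonempty X := ⟨b⟩
  obtain ⟨a, y, F, ha0, hF0, hF, hd, hyF, -, hQ⟩ := exists_seq_of_step
    (TopologicalSpace.denseSeq X) (fun _ : X => True)
    (fun n F a a' y => a' = y ∧ u y ≤ u a - 1 ∧ ∀ x ∈ F, dist x y + u y ≤ u x + 1 / ((n : ℝ) + 1))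
    (fun n F a _ => by
      obtain ⟨y, h1, h2⟩ := hu.2 F (1 / ((n : ℝ) + 1)) (by positivity) (u a - 1)
      exact ⟨y, y, trivial, rfl, h1, h2⟩) b trivial {b}
  have haF : ∀ n, a n ∈ F n := by
    rintro (_ | n)
    · simp [ha0, hF0]
    · rw [(hQ n).1]; exact hyF n
  have hdec : ∀ n, u (a (n + 1)) ≤ u (a n) - 1 := fun n => by
    rw [(hQ n).1]; exact (hQ n).2.1
  have hdist : ∀ n, ∀ x ∈ F n,
      dist x (a (n + 1)) + u (a (n + 1)) ≤ u x + 1 / ((n : ℝ) + 1) := fun n x hx => by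
    rw [(hQ n).1]; exact (hQ n).2.2 x hx
  have hlim : ∀ x, ∀ ε > 0, ∃ N, ∀ n ≥ N, dist x (a n) + u (a n) ≤ u x + ε := by
    intro x ε hε
    obtain ⟨k, hk⟩ : ∃ k, dist x (TopologicalSpace.denseSeq X k) < ε / 4 := by
      simpa using (TopologicalSpace.denseRange_denseSeq X).exists_dist_lt x
        (show 0 < ε / 4 by linarith)
    obtain ⟨N, hN⟩ := exists_nat_one_div_lt (show 0 < ε / 4 by linarith)
    refine ⟨max (k + 1) N + 1, fun n hn => ?_⟩
    obtain ⟨m, rfl⟩ : ∃ m, n = m + 1 := ⟨n - 1, by omega⟩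
    have hm : max (k + 1) N ≤ m := by omega
    have h1 := hdist m _ (hF ((le_max_left _ _).trans hm) (hd k))
    have h2 : 1 / ((m : ℝ) + 1) ≤ 1 / ((N : ℝ) + 1) :=
      Nat.one_div_le_one_div ((le_max_right _ _).trans hm)
    have h3 := hu.1 (TopologicalSpace.denseSeq X k) x
    rw [dist_comm] at h3
    linarith [dist_triangle x (TopologicalSpace.denseSeq X k) (a (m + 1))]
  set t : ℕ → ℝ := fun n => u b - u (a n) with ht
  have htmono : StrictMono t := strictMono_nat_of_lt_succ fun n => by
    have := hdec n
    simp only [ht]; linarith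
  have ht0 : t 0 = 0 := by simp [ht, ha0]
  have htn : ∀ n : ℕ, (n : ℝ) ≤ t n := by
    intro n
    induction n with
    | zero => simp [ht0]
    | succ n ih =>
      have := hdec n
      simp only [ht] at ih ⊢
      push_cast; linarith
  set γ : ℝ → X := fun s => a (Function.invFun t s) with hγdef
  have hγ : ∀ n, γ (t n) = a n := fun n => by
    simp only [hγdef, Function.leftInverse_invFun htmono.injective n]
  have hγ0 : γ 0 = b := by rw [← ht0, hγ, ha0]
  refine ⟨Set.range t, γ, ⟨?_, ⟨0, ht0⟩, ?_, ?_⟩, fun x => ?_⟩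
  · rintro _ ⟨n, rfl⟩
    exact (Nat.cast_nonneg n).trans (htn n)
  · rintro ⟨c, hc⟩
    obtain ⟨n, hn⟩ := exists_nat_gt c
    exact absurd (hc ⟨n, rfl⟩) (not_le.2 (hn.trans_le (htn n)))
  · intro ε hε
    obtain ⟨N₁, hN₁⟩ := hlim b (ε / 3) (by linarith)
    obtain ⟨N₂, hN₂⟩ := exists_nat_one_div_lt (show 0 < ε / 3 by linarith)
    refine ⟨t (max N₁ N₂), ?_⟩
    rintro _ ⟨n, rfl⟩ _ ⟨m, rfl⟩ hn hnm
    rw [htmono.le_iff_le] at hn hnm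
    rw [hγ, hγ, hγ0, dist_comm (a m), dist_comm (a n) b]
    have h1 := hN₁ n ((le_max_left _ _).trans hn)
    have h2 := hu.1 b (a n)
    have h3 := hu.1 (a n) (a m)
    have h4 : dist (a n) (a m) + u (a m) ≤ u (a n) + ε / 3 := by
      rcases hnm.eq_or_lt with rfl | hlt
      · simp; linarith
      · obtain ⟨k, rfl⟩ : ∃ k, m = k + 1 := ⟨m - 1, by omega⟩
        have hnk : n ≤ k := by omega
        have := hdist k (a n) (hF hnk (haF n))
        have h5 : 1 / ((k : ℝ) + 1) ≤ 1 / ((N₂ : ℝ) + 1) :=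
          Nat.one_div_le_one_div (((le_max_right _ _).trans hn).trans hnk)
        linarith
    simp only [ht]
    rw [abs_lt]
    constructor <;> linarith
  · rw [Metric.tendsto_nhds]
    intro ε hε
    obtain ⟨N₁, hN₁⟩ := hlim b (ε / 3) (by linarith)
    obtain ⟨N₂, hN₂⟩ := hlim x (ε / 3) (by linarith)
    filter_upwards [eventually_atTop_inf_principal (t (max N₁ N₂))] with s hs
    obtain ⟨hs, n, rfl⟩ := hs
    rw [htmono.le_iff_le] at hs
    have h1 := hN₁ n ((le_max_left _ _).trans hs)
    have h2 := hN₂ n ((le_max_right _ _).trans hs)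
    rw [hγ, Real.dist_eq, abs_lt]
    constructor <;> linarith [hu.1 b (a n), hu.1 x (a n)]

/-! ### Distance-like functions -/

/-- The sublevel set of a Busemann function at level `t` is reached from `x` by following a geodesic
towards a far point `z` with `u x ≈ dist x z + u z`, up to distance `t - u z` from `z`. -/
lemma IsBusemannFunction.exists_dist_le (hX : IsGeodesicSpace X) {u : X → ℝ}
    (hu : IsBusemannFunction u) (x : X) {t : ℝ} (ht : t ≤ u x) {ε : ℝ} (hε : 0 < ε) :
    ∃ y, u y ≤ t ∧ dist x y ≤ u x - t + ε := by
  obtain ⟨z, hz, hzx⟩ := hu.2 {x} ε hε t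
  have hzx := hzx x (Finset.mem_singleton_self x)
  have hl := hu.1 x z
  obtain ⟨γ, h0, h1, hγ⟩ := hX x z
  have hmem : dist x z - (t - u z) ∈ Set.Icc 0 (dist x z) := ⟨by linarith, by linarith⟩
  refine ⟨γ (dist x z - (t - u z)), ?_, ?_⟩
  · have h2 := hγ _ hmem _ (Set.right_mem_Icc.2 dist_nonneg)
    rw [h1, abs_sub_comm, abs_of_nonneg (by linarith)] at h2
    linarith [hu.1 (γ (dist x z - (t - u z))) z]
  · have h2 := hγ _ (Set.left_mem_Icc.2 dist_nonneg) _ hmem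
    rw [h0, abs_sub_comm, abs_of_nonneg (by linarith)] at h2
    linarith

lemma isDistanceLike_of_forall_exists (hX : IsGeodesicSpace X) {f : X → ℝ} {E : Set (X → ℝ)}
    (hE : ∀ u ∈ E, IsBusemannFunction u) (hf : ∀ u ∈ E, f ≤ u)
    (hinf : ∀ x, ∀ ε > 0, ∃ u ∈ E, u x < f x + ε) : IsDistanceLike f := by
  intro x t ht
  constructor
  · rintro _ ⟨y, hy, rfl⟩
    refine le_of_forall_pos_le_add fun ε hε => ?_
    obtain ⟨u, hu, huy⟩ := hinf y ε hε
    have hy : f y ≤ t := hy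
    dsimp only
    linarith [(hE u hu).1 x y, hf u hu x]
  · intro m hm
    refine le_of_forall_pos_le_add fun ε hε => ?_
    obtain ⟨u, hu, hux⟩ := hinf x (ε / 2) (by linarith)
    obtain ⟨y, hy, hxy⟩ := (hE u hu).exists_dist_le hX x (ht.trans (hf u hu x))
      (show 0 < ε / 2 by linarith)
    have : m ≤ dist x y := hm ⟨y, (hf u hu y).trans hy, rfl⟩
    linarith

lemma IsDistanceLike.le_add_dist {f : X → ℝ} (hf : IsDistanceLike f) (x y : X) :
    f x ≤ f y + dist x y := by
  rcases le_total (f x) (f y) with h | h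
  · linarith [dist_nonneg (x := x) (y := y)]
  · have : f x - f y ≤ dist x y := (hf x (f y) h).1 ⟨y, le_refl (f y), rfl⟩
    linarith

/-- The Busemann functions lying above `f`. -/
def busemannMajorants (f : X → ℝ) : Set (X → ℝ) := {u | IsBusemannFunction u ∧ f ≤ u}

/-- Along a sequence `a n` of almost-steepest descent of `f`, started at `x₀`, the functions
`dist · (a n) + f (a n)`, corrected by the remaining errors, decrease to a Busemann function. -/
lemma IsDistanceLike.exists_mem_busemannMajorants {f : X → ℝ} (hf : IsDistanceLike f) (x₀ : X)
    {ε : ℝ} (hε : 0 < ε) : ∃ u ∈ busemannMajorants f, u x₀ ≤ f x₀ + ε := by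
  have step : ∀ (n : ℕ) (x : X),
      ∃ y, f y ≤ f x - 1 ∧ dist x y ≤ f x - f y + ε / 2 / 2 ^ (n + 1) := by
    intro n x
    have hpos : 0 < ε / 2 / 2 ^ (n + 1) := by positivity
    obtain ⟨_, ⟨y, hy, rfl⟩, -, h2⟩ := (hf x (f x - 1) (by linarith)).exists_between
      (show f x - (f x - 1) < f x - (f x - 1) + ε / 2 / 2 ^ (n + 1) by linarith)
    have hy : f y ≤ f x - 1 := hy
    exact ⟨y, hy, by linarith⟩
  choose g hg1 hg2 using step
  let a : ℕ → X := fun n => Nat.rec x₀ g n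
  have ha1 : ∀ n, f (a (n + 1)) ≤ f (a n) - 1 := fun n => hg1 n (a n)
  have ha2 : ∀ n, dist (a n) (a (n + 1)) ≤ f (a n) - f (a (n + 1)) + ε / 2 / 2 ^ (n + 1) :=
    fun n => hg2 n (a n)
  have hdec : ∀ n : ℕ, f (a n) ≤ f x₀ - n := by
    intro n
    induction n with
    | zero => simp [a]
    | succ n ih => push_cast; linarith [ha1 n]
  set v : ℕ → X → ℝ := fun n x => dist x (a n) + f (a n) + ε / 2 / 2 ^ n with hv
  have hanti : ∀ x, Antitone fun n => v n x := fun x => antitone_nat_of_succ_le fun n => by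
    have e : ε / 2 / 2 ^ n = 2 * (ε / 2 / 2 ^ (n + 1)) := by rw [pow_succ]; field_simp
    simp only [hv]
    linarith [ha2 n, dist_triangle x (a n) (a (n + 1))]
  have hfv : ∀ n x, f x ≤ v n x := fun n x => by
    have : 0 < ε / 2 / 2 ^ n := by positivity
    simp only [hv]
    linarith [hf.le_add_dist x (a n)]
  have hbdd : ∀ x, BddBelow (Set.range fun n => v n x) := fun x =>
    ⟨f x, by rintro _ ⟨n, rfl⟩; exact hfv n x⟩
  set u : X → ℝ := fun x => ⨅ n, v n x with hu
  have hlim : ∀ x, Tendsto (fun n => v n x) atTop (𝓝 (u x)) := fun x =>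
    tendsto_atTop_ciInf (hanti x) (hbdd x)
  have huv : ∀ n x, u x ≤ v n x := fun n x => ciInf_le (hbdd x) n
  have hua : ∀ n, u (a n) ≤ f (a n) + ε / 2 / 2 ^ n := fun n => by
    simpa [hv] using huv n (a n)
  refine ⟨u, ⟨⟨fun x y => ?_, fun F η hη R => ?_⟩, fun x => le_ciInf fun n => hfv n x⟩, ?_⟩
  · refine le_of_tendsto_of_tendsto (hlim x) ((hlim y).add_const (dist x y)) ?_
    filter_upwards with n
    simp only [hv]
    linarith [dist_triangle x y (a n)]
  · have hev : ∀ᶠ n in atTop, ∀ x ∈ F, v n x < u x + η := by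
      rw [Finset.eventually_all]
      exact fun x _ => (hlim x).eventually_lt_const (by linarith)
    obtain ⟨N, hN⟩ := exists_nat_ge (f x₀ + ε / 2 - R)
    obtain ⟨n, hn, hnN⟩ := (hev.and (eventually_ge_atTop N)).exists
    refine ⟨a n, ?_, fun x hx => ?_⟩
    · have h1 : ε / 2 / 2 ^ n ≤ ε / 2 := div_le_self (by linarith) (one_le_pow₀ (by norm_num))
      have h2 : (N : ℝ) ≤ n := by exact_mod_cast hnN
      linarith [hua n, hdec n]
    · have := hn x hx
      simp only [hv] at this
      linarith [hua n]
  · have h0 : u x₀ ≤ f x₀ + ε / 2 / 2 ^ 0 := hua 0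
    rw [pow_zero, div_one] at h0
    linarith

/-! ### Compactness and minimal majorants -/

lemma Ultrafilter.exists_tendsto_pi {ι X : Type*} (U : Ultrafilter ι) (g : ι → X → ℝ)
    (l r : X → ℝ) (h : ∀ x, ∀ᶠ i in (U : Filter ι), g i x ∈ Set.Icc (l x) (r x)) :
    ∃ w : X → ℝ, Tendsto g U (𝓝 w) := by
  have : ∀ x, ∃ y, Tendsto (fun i => g i x) U (𝓝 y) := fun x => by
    obtain ⟨y, -, hy⟩ := (isCompact_Icc (a := l x) (b := r x)).ultrafilter_le_nhds
      (U.map fun i => g i x) (le_principal_iff.2 (h x))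
    exact ⟨y, hy⟩
  choose w hw using this
  exact ⟨w, tendsto_pi_nhds.2 hw⟩

/-- The pointwise infimum of a chain is its limit in the product topology, so Zorn's lemma applies
downwards to closed sets that are bounded below. -/
lemma exists_minimal_le_of_isClosed {X : Type*} {S : Set (X → ℝ)} (hS : IsClosed S) {f : X → ℝ}
    (hf : ∀ u ∈ S, f ≤ u) {u : X → ℝ} (hu : u ∈ S) : ∃ w ≤ u, Minimal (· ∈ S) w := by
  have hchain : ∀ c ⊆ (OrderDual.ofDual ⁻¹' S : Set (X → ℝ)ᵒᵈ), IsChain (· ≤ ·) c → ∀ v ∈ c,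
      ∃ ub ∈ (OrderDual.ofDual ⁻¹' S : Set (X → ℝ)ᵒᵈ), ∀ z ∈ c, z ≤ ub := by
    intro c hcS hc v hv
    have : Nonempty c := ⟨⟨v, hv⟩⟩
    let e : c → X → ℝ := fun w => OrderDual.ofDual w.1
    have hdir : Directed (fun p q : c => p ≤ q) (id : c → c) := fun p q => by
      rcases hc.total p.2 q.2 with h | h
      exacts [⟨q, h, le_rfl⟩, ⟨p, le_rfl, h⟩]
    have : IsDirectedOrder c := ⟨hdir⟩
    have hanti : ∀ x, Antitone fun w : c => e w x := fun x p q hpq => hpq x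
    have hbdd : ∀ x, BddBelow (Set.range fun w : c => e w x) := fun x =>
      ⟨f x, by rintro _ ⟨w, rfl⟩; exact hf _ (hcS w.2) x⟩
    have hlim : Tendsto e atTop (𝓝 fun x => ⨅ w, e w x) :=
      tendsto_pi_nhds.2 fun x => tendsto_atTop_ciInf (hanti x) (hbdd x)
    exact ⟨OrderDual.toDual fun x => ⨅ w, e w x,
      hS.mem_of_tendsto hlim (Eventually.of_forall fun w => hcS w.2),
      fun w hw x => ciInf_le (hbdd x) ⟨w, hw⟩⟩
  obtain ⟨m, hm, hmax⟩ := zorn_le_nonempty₀ _ hchain (OrderDual.toDual u) hu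
  exact ⟨OrderDual.ofDual m, hm, hmax.1, fun y hy hle => hmax.2 hy hle⟩

lemma le_of_mem_closure {X : Type*} {S : Set (X → ℝ)} {f u : X → ℝ} (hf : ∀ u ∈ S, f ≤ u)
    (hu : u ∈ closure S) : f ≤ u :=
  closure_minimal (t := Set.Ici f) hf isClosed_Ici hu

lemma exists_mem_abs_sub_lt_of_mem_closure {X : Type*} {S : Set (X → ℝ)} {u : X → ℝ}
    (hu : u ∈ closure S) (F : Finset X) {ε : ℝ} (hε : 0 < ε) :
    ∃ v ∈ S, ∀ x ∈ F, |v x - u x| < ε := by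
  have := mem_closure_iff_nhdsWithin_neBot.1 hu
  have h1 : ∀ᶠ v in 𝓝 u, ∀ x ∈ F, |v x - u x| < ε := by
    rw [Finset.eventually_all]
    intro x _
    exact ((continuous_apply x).tendsto u).eventually (Metric.ball_mem_nhds _ hε)
  obtain ⟨v, hv, hvS⟩ := ((h1.filter_mono nhdsWithin_le_nhds).and
    (self_mem_nhdsWithin (s := S))).exists
  exact ⟨v, hvS, hv⟩

/-- A minimal element of the closure of the majorants lies in the closure of any family of majorants
whose infimum is `f`: elements of the family that almost touch `f` at far points of almost-descent
of `w` are almost below `w`. -/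
lemma mem_closure_of_minimal {f : X → ℝ} {E : Set (X → ℝ)} (hE : E ⊆ busemannMajorants f)
    (hinf : ∀ x, ∀ ε > 0, ∃ u ∈ E, u x < f x + ε) {w : X → ℝ}
    (hw : Minimal (· ∈ closure (busemannMajorants f)) w) : w ∈ closure E := by
  have key : ∀ p : Finset X × ℕ, ∃ e ∈ E, ∀ x ∈ p.1, e x ≤ w x + 1 / ((p.2 : ℝ) + 1) := by
    rintro ⟨F, n⟩
    set ε : ℝ := 1 / ((n : ℝ) + 1) with hεdef
    have hε : 0 < ε := by positivity
    obtain ⟨h, hh, hhw⟩ := exists_mem_abs_sub_lt_of_mem_closure hw.1 F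
      (show 0 < ε / 3 by linarith)
    obtain ⟨y, -, hy⟩ := hh.1.2 F (ε / 3) (by linarith) 0
    obtain ⟨e, he, hey⟩ := hinf y (ε / 3) (by linarith)
    refine ⟨e, he, fun x hx => ?_⟩
    linarith [(hE he).1.1 x y, hy x hx, hh.2 y, (abs_lt.1 (hhw x hx)).2]
  choose e he hew using key
  classical
  let U : Ultrafilter (Finset X × ℕ) := Ultrafilter.of atTop
  have hU : (U : Filter (Finset X × ℕ)) ≤ atTop := Ultrafilter.of_le _
  have hbound : ∀ x, ∀ ε > 0, ∀ᶠ p in (U : Filter _), e p x ≤ w x + ε := by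
    intro x ε hε
    obtain ⟨N, hN⟩ := exists_nat_one_div_lt hε
    filter_upwards [hU (eventually_ge_atTop (({x} : Finset X), N))] with p hp
    have h1 : 1 / ((p.2 : ℝ) + 1) ≤ 1 / ((N : ℝ) + 1) := Nat.one_div_le_one_div hp.2
    linarith [hew p x (hp.1 (Finset.mem_singleton_self x))]
  obtain ⟨g, hg⟩ := U.exists_tendsto_pi e f (fun x => w x + 1) fun x => by
    filter_upwards [hbound x 1 one_pos] with p hp
    exact ⟨(hE (he p)).2 x, hp⟩
  have hgE : g ∈ closure E := mem_closure_of_tendsto hg (Eventually.of_forall he)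
  have hgw : g ≤ w := fun x => le_of_forall_pos_le_add fun ε hε =>
    le_of_tendsto (tendsto_pi_nhds.1 hg x) (hbound x ε hε)
  rwa [← le_antisymm hgw (hw.2 (closure_mono hE hgE) hgw)]

/-- Stability of a minimal element `w`: some majorant close to `w` on `F` dominates only functions
that are close to `w` on `F`. Otherwise a limit of counterexamples, as the majorants tend to `w`,
would be an element of the closure strictly below `w`. -/
lemma exists_forall_le_close_of_minimal {f w : X → ℝ}
    (hw : Minimal (· ∈ closure (busemannMajorants f)) w) (F : Finset X) {ε : ℝ} (hε : 0 < ε) :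
    ∃ h ∈ busemannMajorants f, (∀ x ∈ F, |h x - w x| < ε) ∧
      ∀ w' ∈ closure (busemannMajorants f), w' ≤ h → ∀ x ∈ F, |w' x - w x| < ε := by
  by_contra! hcon
  have := mem_closure_iff_nhdsWithin_neBot.1 hw.1
  let U : Ultrafilter (X → ℝ) := Ultrafilter.of (𝓝[busemannMajorants f] w)
  have hU : (U : Filter _) ≤ 𝓝[busemannMajorants f] w := Ultrafilter.of_le _
  have hUw : Tendsto (fun h : X → ℝ => h) U (𝓝 w) := hU.trans nhdsWithin_le_nhds
  have hUx := tendsto_pi_nhds.1 hUw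
  have hnear : ∀ᶠ h in (U : Filter (X → ℝ)), ∀ x ∈ F, |h x - w x| < ε := by
    rw [Finset.eventually_all]
    exact fun x _ => (hUx x).eventually (Metric.ball_mem_nhds _ hε)
  have hex : ∀ h : X → ℝ, ∃ w' : X → ℝ, (h ∈ busemannMajorants f ∧ ∀ x ∈ F, |h x - w x| < ε) →
      w' ∈ closure (busemannMajorants f) ∧ w' ≤ h ∧ ∃ x ∈ F, ε ≤ |w' x - w x| := by
    intro h
    by_cases hh : h ∈ busemannMajorants f ∧ ∀ x ∈ F, |h x - w x| < ε
    · obtain ⟨w', h1, h2, h3⟩ := hcon h hh.1 hh.2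
      exact ⟨w', fun _ => ⟨h1, h2, h3⟩⟩
    · exact ⟨h, fun h' => absurd h' hh⟩
  choose g hg using hex
  have hgU : ∀ᶠ h in (U : Filter (X → ℝ)), g h ∈ closure (busemannMajorants f) ∧ g h ≤ h ∧
      ∃ x ∈ F, ε ≤ |g h x - w x| := by
    filter_upwards [hU self_mem_nhdsWithin, hnear] with h h1 h2 using hg h ⟨h1, h2⟩
  obtain ⟨v, hv⟩ := U.exists_tendsto_pi g f (fun x => w x + 1) fun x => by
    filter_upwards [hgU, (hUx x).eventually_lt_const (show w x < w x + 1 by linarith)] with h h1 h2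
    exact ⟨le_of_mem_closure (fun u hu => hu.2) h1.1 x, (h1.2.1 x).trans h2.le⟩
  have hvx := tendsto_pi_nhds.1 hv
  have hvM : v ∈ closure (busemannMajorants f) :=
    isClosed_closure.mem_of_tendsto hv (hgU.mono fun _ h => h.1)
  have hvw : v ≤ w := fun x =>
    le_of_tendsto_of_tendsto (hvx x) (hUx x) (hgU.mono fun _ h => h.2.1 x)
  obtain rfl : v = w := le_antisymm hvw (hw.2 hvM hvw)
  have hclose : ∀ᶠ h in (U : Filter (X → ℝ)), ∀ x ∈ F, |g h x - v x| < ε := by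
    rw [Finset.eventually_all]
    exact fun x _ => (hvx x).eventually (Metric.ball_mem_nhds _ hε)
  obtain ⟨h, h1, h2⟩ := (hgU.and hclose).exists
  obtain ⟨x, hx, hxε⟩ := h1.2.2
  exact absurd (h2 x hx) (not_lt.2 hxε)

/-- A minimal element can be perturbed, slightly on `F`, to a minimal element that is approximated
on `F` by `dist · y` plus a constant, with `y` at a prescribed low level. -/
lemma exists_minimal_close {f w : X → ℝ}
    (hw : Minimal (· ∈ closure (busemannMajorants f)) w) (F : Finset X) {ε : ℝ} (hε : 0 < ε)
    (R : ℝ) : ∃ (w' : X → ℝ) (y : X), Minimal (· ∈ closure (busemannMajorants f)) w' ∧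
      (∀ x ∈ F, |w' x - w x| ≤ ε) ∧ w' y ≤ R ∧ ∀ x ∈ F, dist x y + w' y ≤ w' x + ε := by
  obtain ⟨h, hh, hF, hstab⟩ := exists_forall_le_close_of_minimal hw F (show 0 < ε / 3 by linarith)
  obtain ⟨w', hle, hmin⟩ := exists_minimal_le_of_isClosed isClosed_closure
    (fun u hu => le_of_mem_closure (fun u hu => hu.2) hu) (subset_closure hh)
  obtain ⟨y, hy, hyF⟩ := hh.1.2 F (ε / 3) (by linarith) R
  have hw' := hstab w' hmin.1 hle
  refine ⟨w', y, hmin, fun x hx => (hw' x hx).le.trans (by linarith), (hle y).trans hy,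
    fun x hx => ?_⟩
  linarith [hyF x hx, hle y, (abs_lt.1 (hF x hx)).2, (abs_lt.1 (hw' x hx)).1]

lemma le_add_dist_of_mem_closure {f u : X → ℝ} (hu : u ∈ closure (busemannMajorants f)) (x y : X) :
    u x ≤ u y + dist x y :=
  closure_minimal (t := {u : X → ℝ | u x ≤ u y + dist x y}) (fun _ hu => hu.1.1 x y)
    (isClosed_le (continuous_apply x) ((continuous_apply y).add continuous_const)) hu

/-- Iterating `exists_minimal_close` with summable errors along finite sets exhausting a dense
subset, and passing to a limit, yields a Busemann function. -/
lemma exists_isBusemannFunction_mem_closure_minimal [TopologicalSpace.SeparableSpace X]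
    {f w₀ : X → ℝ} (hw₀ : Minimal (· ∈ closure (busemannMajorants f)) w₀) (x₀ : X)
    {ε : ℝ} (hε : 0 < ε) :
    ∃ u ∈ closure {w | Minimal (· ∈ closure (busemannMajorants f)) w},
      IsBusemannFunction u ∧ u x₀ ≤ w₀ x₀ + ε := by
  have : Nonempty X := ⟨x₀⟩
  set δ : ℕ → ℝ := fun n => ε / 2 / 2 ^ n with hδ
  have hδpos : ∀ n, 0 < δ n := fun n => by simp only [hδ]; positivity
  have hδsucc : ∀ n, δ n = 2 * δ (n + 1) := fun n => by
    simp only [hδ]; rw [pow_succ]; field_simp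
  have hδ0 : δ 0 = ε / 2 := by simp [hδ]
  have hδanti : Antitone δ := antitone_nat_of_succ_le fun n => by
    linarith [hδsucc n, hδpos (n + 1)]
  have hδlim : Tendsto δ atTop (𝓝 0) :=
    tendsto_const_nhds.div_atTop (tendsto_pow_atTop_atTop_of_one_lt one_lt_two)
  obtain ⟨w, y, F, hw0, hF0, hF, hd, hy, hmin, hQ⟩ := exists_seq_of_step
    (TopologicalSpace.denseSeq X) (Minimal (· ∈ closure (busemannMajorants f)))
    (fun n F w w' y => (∀ x ∈ F, |w' x - w x| ≤ δ n) ∧ w' y ≤ -(n : ℝ) ∧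
      ∀ x ∈ F, dist x y + w' y ≤ w' x + δ n)
    (fun n F w hw => exists_minimal_close hw F (hδpos n) _) w₀ hw₀ {x₀}
  -- Since `∑ i ≥ n, δ i = 2 * δ n`, the successive changes sum to at most `2 * δ n` on `F n`.
  have hcauchy : ∀ n k, ∀ x ∈ F n, |w (n + k) x - w n x| ≤ 2 * δ n - 2 * δ (n + k) := by
    intro n k x hx
    induction k with
    | zero => simp
    | succ k ih =>
      have h1 := (hQ (n + k)).1 x (hF (Nat.le_add_right n k) hx)
      have h2 := abs_sub_le (w (n + (k + 1)) x) (w (n + k) x) (w n x)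
      have h3 := hδsucc (n + k)
      rw [← add_assoc] at h2 ⊢
      linarith
  have hclose : ∀ n m, n ≤ m → ∀ x ∈ F n, |w m x - w n x| ≤ 2 * δ n := by
    intro n m hnm x hx
    obtain ⟨k, rfl⟩ := Nat.exists_eq_add_of_le hnm
    linarith [hcauchy n k x hx, hδpos (n + k)]
  have hx₀ : x₀ ∈ F 0 := by simp [hF0]
  let U : Ultrafilter ℕ := Ultrafilter.of atTop
  have hU : (U : Filter ℕ) ≤ atTop := Ultrafilter.of_le _
  obtain ⟨u, hu⟩ := U.exists_tendsto_pi w f (fun x => w₀ x₀ + ε + dist x x₀) fun x => by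
    refine Eventually.of_forall fun n =>
      ⟨le_of_mem_closure (fun u hu => hu.2) (hmin n).1 x, ?_⟩
    have := (abs_le.1 (hclose 0 n n.zero_le x₀ hx₀)).2
    rw [hw0] at this
    linarith [le_add_dist_of_mem_closure (hmin n).1 x x₀]
  have hux := tendsto_pi_nhds.1 hu
  have huclose : ∀ n, ∀ x ∈ F n, |u x - w n x| ≤ 2 * δ n := fun n x hx => by
    refine le_of_tendsto ((hux x).sub_const (w n x)).abs ?_
    filter_upwards [hU (eventually_ge_atTop n)] with m hm using hclose n m hm x hx
  have hucl : u ∈ closure (busemannMajorants f) :=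
    isClosed_closure.mem_of_tendsto hu (Eventually.of_forall fun n => (hmin n).1)
  have hlip := le_add_dist_of_mem_closure hucl
  refine ⟨u, mem_closure_of_tendsto hu (Eventually.of_forall hmin), ⟨hlip, ?_⟩, ?_⟩
  · intro G η hη R
    have happrox : ∀ x : X, ∃ k, dist x (TopologicalSpace.denseSeq X k) < η / 4 := fun x => by
      simpa using (TopologicalSpace.denseRange_denseSeq X).exists_dist_lt x
        (show 0 < η / 4 by linarith)
    choose k hk using happrox
    obtain ⟨N, hN⟩ := exists_nat_ge (ε - R)
    obtain ⟨n, ⟨hnδ, hnN⟩, hnk⟩ := (((hδlim.eventually_lt_const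
      (show 0 < η / 6 by linarith)).and (eventually_ge_atTop N)).and
      (eventually_ge_atTop (G.sup fun x => k x + 1))).exists
    have hnN : (N : ℝ) ≤ n := by exact_mod_cast hnN
    have huy := (abs_le.1 (huclose (n + 1) (y n) (hy n))).2
    have hs := hδsucc n
    refine ⟨y n, ?_, fun x hx => ?_⟩
    · have := hδanti n.zero_le
      linarith [(hQ n).2.1]
    · have hz : TopologicalSpace.denseSeq X (k x) ∈ F n :=
        hF ((Finset.le_sup (f := fun x => k x + 1) hx).trans hnk) (hd (k x))
      have h1 := (hQ n).2.2 _ hz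
      have h2 := (abs_le.1 (huclose (n + 1) _ (hF n.le_succ hz))).1
      have h3 := hlip (TopologicalSpace.denseSeq X (k x)) x
      rw [dist_comm] at h3
      linarith [hk x, dist_triangle x (TopologicalSpace.denseSeq X (k x)) (y n)]
  · have := (abs_le.1 (huclose 0 x₀ hx₀)).2
    rw [hw0] at this
    linarith

/-! ### Representing maps -/

/-- The epigraph of `ν`, with the pair `(h, c)` encoded as the function `h + c`. This loses nothing,
since `h b = 0`. -/
def epigraphFunctions {b : X} (ν : busemannPoints b → EReal) : Set (X → ℝ) :=
  {u | ∃ (h : busemannPoints b) (c : ℝ), ν h ≤ c ∧ u = fun x => (h : X → ℝ) x + c}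

lemma epigraphFunctions_subset {b : X} {f : X → ℝ} {ν : busemannPoints b → EReal}
    (hν : ν ∈ representingMaps b f) : epigraphFunctions ν ⊆ busemannMajorants f := by
  rintro _ ⟨h, c, hc, rfl⟩
  refine ⟨(isBusemannFunction_of_mem_busemannPoints h.2).add_const c, fun x => ?_⟩
  have h1 : (f x : EReal) ≤ ((h : X → ℝ) x : EReal) + ν h := (hν.2.2 x).trans_le (iInf_le _ h)
  have h2 := h1.trans (add_le_add_right hc _)
  exact_mod_cast h2

lemma exists_mem_epigraphFunctions_lt {b : X} {f : X → ℝ} {ν : busemannPoints b → EReal}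
    (hν : ν ∈ representingMaps b f) (x : X) {ε : ℝ} (hε : 0 < ε) :
    ∃ u ∈ epigraphFunctions ν, u x < f x + ε := by
  have h1 : (⨅ h : busemannPoints b, (((h : X → ℝ) x : EReal) + ν h)) <
      ((f x + ε : ℝ) : EReal) := by
    rw [← hν.2.2 x]
    exact_mod_cast (by linarith : f x < f x + ε)
  obtain ⟨h, hh⟩ := iInf_lt_iff.1 h1
  obtain ⟨c, hc⟩ := hν.2.1
  -- The real lower bound on `ν` rules out the value `⊥`.
  have hbot : ν h ≠ ⊥ := fun e => by simpa [e] using hc h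
  have htop : ν h ≠ ⊤ := fun e => by simp [e] at hh
  refine ⟨_, ⟨h, (ν h).toReal, (EReal.coe_toReal htop hbot).ge, rfl⟩, ?_⟩
  rw [← EReal.coe_toReal htop hbot] at hh
  exact_mod_cast hh

lemma le_of_mem_closure_epigraphFunctions {b : X} {ν : busemannPoints b → EReal}
    (hν : LowerSemicontinuous ν) (h : busemannPoints b) {c : ℝ}
    (hc : (fun x => (h : X → ℝ) x + c) ∈ closure (epigraphFunctions ν)) : ν h ≤ c := by
  by_contra! hlt
  obtain ⟨a, hca, hah⟩ := EReal.lt_iff_exists_real_btwn.1 hlt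
  have hca : c < a := by exact_mod_cast hca
  obtain ⟨O, hO, hOν⟩ := mem_nhds_subtype _ _ _ |>.1 (hν h a hah)
  set w : X → ℝ := fun x => (h : X → ℝ) x + c with hw
  have hwb : w b = c := by simp [hw, busemannPoints_apply_base h.2]
  have hcont : Tendsto (fun u : X → ℝ => fun x => u x - u b) (𝓝 w) (𝓝 (h : X → ℝ)) := by
    have : Continuous fun u : X → ℝ => fun x => u x - u b := by fun_prop
    have h1 := this.tendsto w
    have e : (fun x => w x - w b) = (h : X → ℝ) := by
      funext x; rw [hwb]; simp [hw]
    rwa [e] at h1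
  have := mem_closure_iff_nhdsWithin_neBot.1 hc
  have h1 : ∀ᶠ u in 𝓝 w, u b < a :=
    ((continuous_apply b).tendsto w).eventually_lt_const (by rwa [hwb])
  obtain ⟨u, ⟨hu1, hu2⟩, h', c', hc', rfl⟩ :=
    (((h1.and (hcont hO)).filter_mono nhdsWithin_le_nhds).and
      (self_mem_nhdsWithin (s := epigraphFunctions ν))).exists
  have hb' := busemannPoints_apply_base h'.2
  have e : (fun x => ((h' : X → ℝ) x + c') - ((h' : X → ℝ) b + c')) = (h' : X → ℝ) := by
    funext x; rw [hb']; ring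
  have hmem : (h' : X → ℝ) ∈ O := by
    have : (fun x => ((h' : X → ℝ) x + c') - ((h' : X → ℝ) b + c')) ∈ O := hu2
    rwa [e] at this
  have h3 : (a : EReal) < ν h' := hOν hmem
  have h4 : a < c' := by exact_mod_cast h3.trans_le hc'
  simp only [hb', zero_add] at hu1
  linarith

/-- The closed set generated by the minimal elements of the closure of the majorants of `f` and by
the addition of nonnegative constants. The constants make it an epigraph. -/
def essentialFunctions (f : X → ℝ) : Set (X → ℝ) :=
  closure {u | ∃ (w : X → ℝ) (c : ℝ), Minimal (· ∈ closure (busemannMajorants f)) w ∧ 0 ≤ c ∧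
    u = fun x => w x + c}

lemma essentialFunctions_add_const {f u : X → ℝ} (hu : u ∈ essentialFunctions f) {c : ℝ}
    (hc : 0 ≤ c) : (fun x => u x + c) ∈ essentialFunctions f := by
  refine map_mem_closure (f := fun (u : X → ℝ) x => u x + c) (by fun_prop) hu ?_
  rintro _ ⟨w, c', hw, hc', rfl⟩
  exact ⟨w, c' + c, hw, by linarith, by funext x; ring⟩

lemma le_of_mem_essentialFunctions {f u : X → ℝ} (hu : u ∈ essentialFunctions f) : f ≤ u := by
  refine le_of_mem_closure ?_ hu
  rintro _ ⟨w, c, hw, hc, rfl⟩ x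
  have := le_of_mem_closure (fun u hu => hu.2) hw.1 x
  dsimp only
  linarith

lemma essentialFunctions_subset_closure {b : X} {f : X → ℝ} {ν : busemannPoints b → EReal}
    (hν : ν ∈ representingMaps b f) : essentialFunctions f ⊆ closure (epigraphFunctions ν) := by
  refine closure_minimal ?_ isClosed_closure
  rintro _ ⟨w, c, hw, hc, rfl⟩
  refine map_mem_closure (f := fun (u : X → ℝ) x => u x + c) (by fun_prop)
    (mem_closure_of_minimal (epigraphFunctions_subset hν)
      (fun x ε hε => exists_mem_epigraphFunctions_lt hν x hε) hw) ?_
  rintro _ ⟨h, c', hc', rfl⟩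
  refine ⟨h, c' + c, hc'.trans ?_, by funext x; ring⟩
  exact_mod_cast (by linarith : c' ≤ c' + c)

/-- The map whose epigraph consists of the essential functions of the form `h + c` with `h` a
Busemann point; its value is `⊤` if there is no such `c`. -/
noncomputable def greatestMap (b : X) (f : X → ℝ) (h : busemannPoints b) : EReal :=
  ⨅ c : {c : ℝ // (fun x => (h : X → ℝ) x + c) ∈ essentialFunctions f}, ((c : ℝ) : EReal)

lemma lowerSemicontinuous_greatestMap (b : X) (f : X → ℝ) :
    LowerSemicontinuous (greatestMap b f) := by
  rw [lowerSemicontinuous_iff_isClosed_preimage]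
  intro y
  have : greatestMap b f ⁻¹' Set.Iic y = ⋂ z : {z : ℝ // y < z},
      {h : busemannPoints b | (fun x => (h : X → ℝ) x + (z : ℝ)) ∈ essentialFunctions f} := by
    ext h
    simp only [Set.mem_preimage, Set.mem_Iic, Set.mem_iInter, Set.mem_ofPred_eq]
    constructor
    · rintro hy ⟨z, hz⟩
      obtain ⟨⟨c, hc⟩, hcz⟩ := iInf_lt_iff.1 (hy.trans_lt hz)
      have hcz : c < z := by exact_mod_cast hcz
      have := essentialFunctions_add_const hc (sub_nonneg.2 hcz.le)
      simpa [add_assoc] using this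
    · intro hz
      refine EReal.le_of_forall_lt_iff_le.1 fun z hyz => ?_
      exact iInf_le (fun c : {c : ℝ // (fun x => (h : X → ℝ) x + c) ∈ essentialFunctions f} =>
        ((c : ℝ) : EReal)) ⟨z, hz ⟨z, hyz⟩⟩
  rw [this]
  refine isClosed_iInter fun z => isClosed_closure.preimage ?_
  exact continuous_pi fun x =>
    ((continuous_apply x).comp continuous_subtype_val).add continuous_const

/-- Each majorant of `f` touching it almost at `x` dominates a minimal element, which can be replaced
by an essential Busemann function at a small cost at `x`. -/
lemma greatestMap_mem_representingMaps [TopologicalSpace.SeparableSpace X] (b : X) {f : X → ℝ}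
    (hf : IsDistanceLike f) : greatestMap b f ∈ representingMaps b f := by
  refine ⟨lowerSemicontinuous_greatestMap b f, ⟨f b, fun h => le_iInf fun c => ?_⟩,
    fun x => le_antisymm (le_iInf fun h => ?_) ?_⟩
  · have := le_of_mem_essentialFunctions c.2 b
    rw [busemannPoints_apply_base h.2, zero_add] at this
    exact_mod_cast this
  · rw [add_comm, ← EReal.sub_le_iff_le_add (Or.inl (EReal.coe_ne_bot _))
      (Or.inl (EReal.coe_ne_top _))]
    refine le_iInf fun c => ?_
    have := le_of_mem_essentialFunctions c.2 x
    rw [← EReal.coe_sub]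
    exact_mod_cast (by linarith : f x - (h : X → ℝ) x ≤ c)
  · refine EReal.le_of_forall_lt_iff_le.1 fun z hz => ?_
    have hz : f x < z := by exact_mod_cast hz
    obtain ⟨v, hv, hvx⟩ := hf.exists_mem_busemannMajorants x (show 0 < (z - f x) / 2 by linarith)
    obtain ⟨w, hwv, hw⟩ := exists_minimal_le_of_isClosed isClosed_closure
      (fun u hu => le_of_mem_closure (fun u hu => hu.2) hu) (subset_closure hv)
    obtain ⟨u, huK, hu, hux⟩ := exists_isBusemannFunction_mem_closure_minimal hw x
      (show 0 < (z - f x) / 2 by linarith)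
    have huE : u ∈ essentialFunctions f := by
      refine closure_mono ?_ huK
      exact fun w hw => ⟨w, 0, hw, le_rfl, by simp⟩
    let h : busemannPoints b := ⟨fun x => u x - u b, sub_apply_base_mem_busemannPoints b hu⟩
    have hle : greatestMap b f h ≤ (u b : EReal) :=
      iInf_le (fun c : {c : ℝ // (fun x => (h : X → ℝ) x + c) ∈ essentialFunctions f} =>
        ((c : ℝ) : EReal)) ⟨u b, by simpa [h] using huE⟩
    refine (iInf_le _ h).trans ((add_le_add_right hle _).trans ?_)
    have : (u x - u b) + u b ≤ z := by linarith [hwv x]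
    exact_mod_cast this

end

theorem theorem1p2 {X : Type*} [MetricSpace X] [ProperSpace X] (hX : IsGeodesicSpace X) (b : X) :
    (∀ f : X → ℝ, IsDistanceLike f ↔ ∃ ν : busemannPoints b → EReal, ν ∈ representingMaps b f) ∧
    (∀ f : X → ℝ, IsDistanceLike f →
      ∃ ν : busemannPoints b → EReal, IsGreatest (representingMaps b f) ν) := by
  refine ⟨fun f => ⟨fun hf => ⟨_, greatestMap_mem_representingMaps b hf⟩, ?_⟩, fun f hf =>
    ⟨_, greatestMap_mem_representingMaps b hf, fun ν hν h => le_iInf fun c => ?_⟩⟩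
  · rintro ⟨ν, hν⟩
    exact isDistanceLike_of_forall_exists hX (fun u hu => (epigraphFunctions_subset hν hu).1)
      (fun u hu => (epigraphFunctions_subset hν hu).2)
      (fun x ε hε => exists_mem_epigraphFunctions_lt hν x hε)
  · exact le_of_mem_closure_epigraphFunctions hν.1 h
      (essentialFunctions_subset_closure hν c.2)
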